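/- **Setting.** Let $(\Omega,\mathcal F,P)$ be a probability space; random variables are identified when they agree $P$-almost surely, and $E=E_P$. A *loss function* is an increasing (not necessarily strictly), convex function $l:\mathbb R\to\mathbb R$ with $l(0)=0$ and $l(x)\ge x$ for all $x$. Let $l'_-$, $l'_+$ be its left- and right-hand derivatives and $l^*(y)=\sup_{x\in\mathbb R}\{xy-l(x)\}\in[0,+\infty]$ its convex conjugate. The Orlicz heart is $$\mathcal X_l=\{X: E[l(c|X|)]<\infty\ \text{for all } c>0\},\qquad \|X\|_l=\inf\{a>0: E[l(|X|/a)]\le 1\},$$ the Orlicz space of $l^*$ is $\mathcal X_l^*=\{Y: E[l^*(c|Y|)]<\infty\ \text{for some } c>0\}$, and $\mathcal M_{1,l^*}(P)$ is the set of probability measures $Q\ll P$ with $dQ/dP\in\mathcal X_l^*$. A *risk measure* is a function $\rho:\mathcal X_l\to[-\infty,+\infty]$ that is quasi-convex, i.e. $\rho(\lambda X+(1-\lambda)Y)\le\max\{\rho(X),\rho(Y)\}$ for $\lambda\in(0,1)$, and monotone, i.e. $\rho(X)\ge\rho(Y)$ whenever $X\le Y$; it is *cash additive* if $\rho(X+m)=\rho(X)-m$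 for all $m\in\mathbb R$. The *optimized certainty equivalent* (OCE) is $$\rho(X)=\inf_{\eta\in\mathbb R}\{E[l(\eta-X)]-\eta\},\qquad X\in\mathcal X_l.$$ **Proposition.** Let $l$ be a loss function. 1. For all $X\in\mathcal X_l$ and $\eta\in\mathbb R$ the random variable $l(\eta-X)$ is integrable. The OCE is a cash additive risk measure on $\mathcal X_l$ with values in $\mathbb R$, and it is lower semicontinuous with respect to $\|\cdot\|_l$. 2. Suppose in addition (A): $l(x)>x$ for all $x$ with $|x|$ large enough. Then for every $X\in\mathcal X_l$ there is an optimal allocation $\eta^*\in\mathbb R\cap[\operatorname{ess\,inf}X,\operatorname{ess\,sup}X]$, i.e. $\rho(X)=E[l(\eta^*-X)]-\eta^*$, and it satisfies $$E[l'_-(\eta^*-X)]\le 1\le E[l'_+(\eta^*-X)].\tag{1}$$ 3. For all $X\in\mathcal X_l$ and $\eta^*\in\mathbb R$, the random variables $l'_\pm(\eta^*-X)$ are integrable, and $\rho(X)=E[l(\eta^*-X)]-\eta^*$ holds if and only if $\eta^*$ satisfies (1). 4. For every $X\in\mathcal X_l$, $X$ is $Q$-integrable for all $Q\in\mathcal M_{1,l^*}(P)$,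 and $$\rho(X)=\max_{Q\in\mathcal M_{1,l^*}(P)}\Big\{E_Q[-X]-E\Big[l^*\Big(\frac{dQ}{dP}\Big)\Big]\Big\},$$ where the maximum is attained. 5. Let $X\in\mathcal X_l$ and let $\eta^*$ satisfy (1). Then $Q^*\in\mathcal M_{1,l^*}(P)$ attains the maximum in 4 if and only if $l'_-(\eta^*-X)\le dQ^*/dP\le l'_+(\eta^*-X)$ holds $P$-almost surely. -/

import Mathlib

open MeasureTheory

/-- A loss function: increasing, convex, `l 0 = 0` and `l x ≥ x`. -/
structure IsLossFunction (l : ℝ → ℝ) : Prop where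
  monotone : Monotone l
  convexOn : ConvexOn ℝ Set.univ l
  map_zero : l 0 = 0
  le_apply : ∀ x, x ≤ l x

/-- The strict form of risk aversion: `l x > x` whenever `|x|` is large enough. -/
def StrictlyAboveAtInfinity (l : ℝ → ℝ) : Prop :=
  ∃ M : ℝ, ∀ x : ℝ, M ≤ |x| → x < l x

/-- The convex conjugate `l* y = sup_x (x y - l x)`, with values in the extended reals. -/
noncomputable def convexConjugate (l : ℝ → ℝ) (y : ℝ) : EReal :=
  ⨆ x : ℝ, ((x * y - l x : ℝ) : EReal)

/-- The conjugate of a loss function is nonnegative, because `l 0 = 0`. -/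
theorem convexConjugate_nonneg {l : ℝ → ℝ} (hl : IsLossFunction l) (y : ℝ) :
    0 ≤ convexConjugate l y :=
  le_iSup_of_le 0 (by simp [hl.map_zero])

/-- The left-hand derivative. -/
noncomputable def leftDeriv (l : ℝ → ℝ) (x : ℝ) : ℝ := derivWithin l (Set.Iio x) x

/-- The right-hand derivative. -/
noncomputable def rightDeriv (l : ℝ → ℝ) (x : ℝ) : ℝ := derivWithin l (Set.Ioi x) x

/-- The Orlicz heart: classes of random variables with `E[l(c|X|)] < ∞` for all `c > 0`.
(`l(c|X|)` is nonnegative and measurable, so a finite expectation means integrability.) -/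
def orliczHeart {Ω : Type*} [MeasurableSpace Ω] (P : Measure Ω) {l : ℝ → ℝ}
    (hl : IsLossFunction l) : Submodule ℝ (Ω →ₘ[P] ℝ) where
  carrier := {X | ∀ c : ℝ, 0 < c → Integrable (fun ω => l (c * |X ω|)) P}
  zero_mem' := by
    intro c _
    refine (integrable_zero Ω ℝ P).congr ?_
    filter_upwards [AEEqFun.coeFn_zero (α := Ω) (β := ℝ) (μ := P)] with ω h
    simp [h, hl.map_zero]
  add_mem' := by
    intro X Y hX hY c hc
    have h2 : (0 : ℝ) < 2 * c := by positivity
    refine Integrable.mono' ((hX _ h2).add (hY _ h2)) ?_ ?_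
    · exact (hl.monotone.measurable.comp_aemeasurable
        (((X + Y).aemeasurable.abs).const_mul c)).aestronglyMeasurable
    · filter_upwards [AEEqFun.coeFn_add X Y] with ω h
      have hpos : ∀ x : ℝ, 0 ≤ x → 0 ≤ l x := fun x hx => hx.trans (hl.le_apply x)
      rw [Real.norm_of_nonneg (hpos _ (by positivity))]
      have hX0 := hpos (2 * c * |X ω|) (by positivity)
      have hY0 := hpos (2 * c * |Y ω|) (by positivity)
      have hle : c * |(X + Y) ω|
          ≤ (1 / 2 : ℝ) * (2 * c * |X ω|) + (1 / 2 : ℝ) * (2 * c * |Y ω|) := by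
        rw [h, Pi.add_apply]
        nlinarith [abs_add_le (X ω) (Y ω)]
      have hcv := hl.convexOn.2 (Set.mem_univ (2 * c * |X ω|)) (Set.mem_univ (2 * c * |Y ω|))
        (by norm_num : (0 : ℝ) ≤ 1 / 2) (by norm_num : (0 : ℝ) ≤ 1 / 2) (by norm_num)
      simp only [smul_eq_mul] at hcv
      have := hl.monotone hle
      simp only [Pi.add_apply]
      linarith
  smul_mem' := by
    intro t X hX c hc
    refine Integrable.mono' (hX (c * (|t| + 1)) (by positivity)) ?_ ?_
    · exact (hl.monotone.measurable.comp_aemeasurable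
        (((t • X).aemeasurable.abs).const_mul c)).aestronglyMeasurable
    · filter_upwards [AEEqFun.coeFn_smul t X] with ω h
      have hpos : ∀ x : ℝ, 0 ≤ x → 0 ≤ l x := fun x hx => hx.trans (hl.le_apply x)
      rw [Real.norm_of_nonneg (hpos _ (by positivity))]
      apply hl.monotone
      rw [h, Pi.smul_apply, smul_eq_mul, abs_mul, mul_assoc]
      gcongr
      linarith

theorem const_mem_orliczHeart {Ω : Type*} [MeasurableSpace Ω] (P : Measure Ω)
    [IsProbabilityMeasure P] {l : ℝ → ℝ} (hl : IsLossFunction l) (m : ℝ) :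
    AEEqFun.const Ω m ∈ orliczHeart P hl := by
  intro c _
  refine (integrable_const (l (c * |m|))).congr ?_
  filter_upwards [AEEqFun.coeFn_const (μ := P) Ω m] with ω h
  rw [h, Function.const_apply]

/-- The constant random variable `m`, as an element of the Orlicz heart. -/
noncomputable def constHeart {Ω : Type*} [MeasurableSpace Ω] (P : Measure Ω)
    [IsProbabilityMeasure P] {l : ℝ → ℝ} (hl : IsLossFunction l) (m : ℝ) : orliczHeart P hl :=
  ⟨AEEqFun.const Ω m, const_mem_orliczHeart P hl m⟩

/-- The Luxemburg norm on the Orlicz heart. -/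
noncomputable def luxemburgNorm {Ω : Type*} [MeasurableSpace Ω] (P : Measure Ω) {l : ℝ → ℝ}
    (hl : IsLossFunction l) (X : orliczHeart P hl) : ℝ :=
  sInf {a : ℝ | 0 < a ∧ ∫ ω, l (|X.1 ω| / a) ∂P ≤ 1}

/-- The topology of the Luxemburg norm: a set is open if it contains a ball around each of its
points. -/
@[reducible]
def luxemburgTopology {Ω : Type*} [MeasurableSpace Ω] (P : Measure Ω) {l : ℝ → ℝ}
    (hl : IsLossFunction l) : TopologicalSpace (orliczHeart P hl) where
  IsOpen U := ∀ X ∈ U, ∃ ε : ℝ, 0 < ε ∧ ∀ Y, luxemburgNorm P hl (Y - X) < ε → Y ∈ U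
  isOpen_univ := fun _ _ => ⟨1, one_pos, fun _ _ => trivial⟩
  isOpen_inter := by
    rintro U V hU hV X ⟨hXU, hXV⟩
    obtain ⟨a, ha, hUa⟩ := hU X hXU
    obtain ⟨b, hb, hVb⟩ := hV X hXV
    exact ⟨min a b, lt_min ha hb, fun Y hY =>
      ⟨hUa Y (hY.trans_le (min_le_left _ _)), hVb Y (hY.trans_le (min_le_right _ _))⟩⟩
  isOpen_sUnion := by
    rintro S hS X ⟨U, hU, hXU⟩
    obtain ⟨a, ha, hUa⟩ := hS U hU X hXU
    exact ⟨a, ha, fun Y hY => ⟨U, hU, hUa Y hY⟩⟩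

/-- A risk measure on the Orlicz heart: quasi-convex and monotone. -/
structure IsRiskMeasure {Ω : Type*} [MeasurableSpace Ω] (P : Measure Ω) {l : ℝ → ℝ}
    (hl : IsLossFunction l) (ρ : orliczHeart P hl → EReal) : Prop where
  quasiconvex : ∀ (X Y : orliczHeart P hl) (t : ℝ), 0 < t → t < 1 →
    ρ (t • X + (1 - t) • Y) ≤ max (ρ X) (ρ Y)
  monotone : ∀ X Y : orliczHeart P hl, (X : Ω →ₘ[P] ℝ) ≤ (Y : Ω →ₘ[P] ℝ) → ρ Y ≤ ρ X

/-- Cash additivity. -/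
def IsCashAdditive {Ω : Type*} [MeasurableSpace Ω] (P : Measure Ω) [IsProbabilityMeasure P]
    {l : ℝ → ℝ} (hl : IsLossFunction l) (ρ : orliczHeart P hl → EReal) : Prop :=
  ∀ (X : orliczHeart P hl) (m : ℝ), ρ (X + constHeart P hl m) = ρ X - (m : EReal)

/-- `S_l(η, X) = E[l(η - X)] - η`. -/
noncomputable def allocationCost {Ω : Type*} [MeasurableSpace Ω] (P : Measure Ω) {l : ℝ → ℝ}
    (hl : IsLossFunction l) (η : ℝ) (X : orliczHeart P hl) : ℝ :=
  (∫ ω, l (η - X.1 ω) ∂P) - η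

/-- The optimized certainty equivalent `ρ(X) = inf_η S_l(η, X)`; the infimum is taken in the
extended reals. -/
noncomputable def oce {Ω : Type*} [MeasurableSpace Ω] (P : Measure Ω) {l : ℝ → ℝ}
    (hl : IsLossFunction l) (X : orliczHeart P hl) : EReal :=
  ⨅ η : ℝ, (allocationCost P hl η X : EReal)

/-- `η` is an optimal allocation for `X`: the infimum defining `ρ(X)` is attained at `η`. -/
def IsOptimalAllocation {Ω : Type*} [MeasurableSpace Ω] (P : Measure Ω) {l : ℝ → ℝ}
    (hl : IsLossFunction l) (X : orliczHeart P hl) (η : ℝ) : Prop :=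
  oce P hl X = (allocationCost P hl η X : EReal)

/-- The first order condition `E[l'₋(η - X)] ≤ 1 ≤ E[l'₊(η - X)]`. -/
def FirstOrderCondition {Ω : Type*} [MeasurableSpace Ω] (P : Measure Ω) {l : ℝ → ℝ}
    (hl : IsLossFunction l) (X : orliczHeart P hl) (η : ℝ) : Prop :=
  ∫ ω, leftDeriv l (η - X.1 ω) ∂P ≤ 1 ∧ 1 ≤ ∫ ω, rightDeriv l (η - X.1 ω) ∂P

/-- The density `dQ/dP`, as a real-valued function. -/
noncomputable def density {Ω : Type*} [MeasurableSpace Ω] (P Q : Measure Ω) (ω : Ω) : ℝ :=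
  (Q.rnDeriv P ω).toReal

/-- `E_P[l*(Y)]`. As `l 0 = 0`, the conjugate `l*` is nonnegative, so that this is a
(possibly infinite) integral of a nonnegative function. -/
noncomputable def conjugateExpectation {Ω : Type*} [MeasurableSpace Ω] (P : Measure Ω)
    (l : ℝ → ℝ) (Y : Ω → ℝ) : ENNReal :=
  ∫⁻ ω, (convexConjugate l (Y ω)).toENNReal ∂P

/-- Membership in the Orlicz space `{Y : E[l*(c|Y|)] < ∞ for some c > 0}`. -/
def MemOrliczDual {Ω : Type*} [MeasurableSpace Ω] (P : Measure Ω) (l : ℝ → ℝ)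
    (Y : Ω → ℝ) : Prop :=
  AEMeasurable Y P ∧ ∃ c : ℝ, 0 < c ∧ conjugateExpectation P l (fun ω => c * |Y ω|) < ⊤

/-- The probability measures `Q ≪ P` whose density lies in the Orlicz space of `l*`. -/
def dualMeasures {Ω : Type*} [MeasurableSpace Ω] (P : Measure Ω) (l : ℝ → ℝ) :
    Set (Measure Ω) :=
  {Q | IsProbabilityMeasure Q ∧ Q ≪ P ∧ MemOrliczDual P l (density P Q)}

/-- The dual objective `E_Q[-X] - E_P[l*(dQ/dP)]`, which may be `-∞`. -/
noncomputable def dualObjective {Ω : Type*} [MeasurableSpace Ω] (P : Measure Ω) {l : ℝ → ℝ}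
    (hl : IsLossFunction l) (X : orliczHeart P hl) (Q : Measure Ω) : EReal :=
  ((∫ ω, -X.1 ω ∂Q : ℝ) : EReal) - (conjugateExpectation P l (density P Q) : EReal)

/-! Everything rests on Young's inequality `x * z ≤ l x + l* z`, with equality exactly when `z` is a
subgradient of `l` at `x`, that is, `z` lies between the one-sided derivatives. With `x = η - X` and
`z = dQ/dP`, integration shows that a dual value never exceeds an allocation cost, and that the two
agree iff the density is a.s. a subgradient (`young_gap`, `dualObjective_eq_allocationCost_iff`). If
`η` satisfies the first order condition, some mixture of the one-sided derivatives has mean one and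
is the density of a dual maximizer.

Under strict risk aversion the cost is convex and coercive in `η`, so a minimizer exists. Otherwise
`l` is the identity on a half-line, the infimum is `-E[X]` (possibly not attained), and `P` itself
is a dual maximizer because `l* 1 = 0`. Hence a dual maximizer always exists, and it supplies a
continuous affine minorant touching the OCE at the given position (`exists_exact_minorant`);
quasi-convexity and lower semicontinuity follow from it. -/

/-- `z` is a subgradient of `l` at `x`. -/
def IsSubgradientAt (l : ℝ → ℝ) (x z : ℝ) : Prop :=
  ∀ y, l x + z * (y - x) ≤ l y

/-! ### Subgradients and elementary bounds for loss functions. -/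

namespace IsLossFunction

variable {l : ℝ → ℝ}

/-- A subgradient bounds the difference quotients on each side, hence their limits; conversely, by
convexity the one-sided derivatives bound all slopes on their side. -/
theorem isSubgradientAt_iff (hl : IsLossFunction l) {x z : ℝ} :
    IsSubgradientAt l x z ↔ leftDeriv l x ≤ z ∧ z ≤ rightDeriv l x := by
  have hx : x ∈ interior (Set.univ : Set ℝ) := by simp
  constructor
  · intro h
    constructor
    · refine le_of_tendsto ((hasDerivWithinAt_iff_tendsto_slope' Set.self_notMem_Iio).mp
        (hl.convexOn.hasDerivWithinAt_leftDeriv_of_mem_interior hx)) ?_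
      filter_upwards [self_mem_nhdsWithin] with y hy
      have hy : y < x := hy
      rw [slope_def_field, div_le_iff_of_neg (by linarith)]
      linarith [h y]
    · refine ge_of_tendsto ((hasDerivWithinAt_iff_tendsto_slope' Set.self_notMem_Ioi).mp
        (hl.convexOn.hasDerivWithinAt_rightDeriv_of_mem_interior hx)) ?_
      filter_upwards [self_mem_nhdsWithin] with y hy
      have hy : x < y := hy
      rw [slope_def_field, le_div_iff₀ (by linarith)]
      linarith [h y]
  · rintro ⟨h₁, h₂⟩ y
    rcases lt_trichotomy y x with hy | rfl | hy
    · have := (hl.convexOn.slope_le_leftDeriv_of_mem_interior (Set.mem_univ y) hx hy).trans h₁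
      rw [slope_def_field, div_le_iff₀ (by linarith)] at this
      linarith
    · simp
    · have := h₂.trans
        (hl.convexOn.rightDeriv_le_slope_of_mem_interior hx (Set.mem_univ y) hy)
      rw [slope_def_field, le_div_iff₀ (by linarith)] at this
      linarith

theorem leftDeriv_le_rightDeriv (hl : IsLossFunction l) (x : ℝ) :
    leftDeriv l x ≤ rightDeriv l x :=
  hl.convexOn.leftDeriv_le_rightDeriv_of_mem_interior (by simp)

theorem isSubgradientAt_leftDeriv (hl : IsLossFunction l) (x : ℝ) :
    IsSubgradientAt l x (leftDeriv l x) :=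
  hl.isSubgradientAt_iff.2 ⟨le_rfl, hl.leftDeriv_le_rightDeriv x⟩

theorem isSubgradientAt_rightDeriv (hl : IsLossFunction l) (x : ℝ) :
    IsSubgradientAt l x (rightDeriv l x) :=
  hl.isSubgradientAt_iff.2 ⟨hl.leftDeriv_le_rightDeriv x, le_rfl⟩

theorem subgradient_nonneg (hl : IsLossFunction l) {x z : ℝ} (h : IsSubgradientAt l x z) :
    0 ≤ z := by
  have h₁ := h (x - 1)
  have h₂ := hl.monotone (show x - 1 ≤ x by linarith)
  linarith

theorem measurable_leftDeriv (hl : IsLossFunction l) : Measurable (leftDeriv l) := by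
  refine Monotone.measurable fun x y hxy => ?_
  exact hl.convexOn.monotoneOn_leftDeriv (by simp) (by simp) hxy

theorem measurable_rightDeriv (hl : IsLossFunction l) : Measurable (rightDeriv l) := by
  refine Monotone.measurable fun x y hxy => ?_
  exact hl.convexOn.monotoneOn_rightDeriv (by simp) (by simp) hxy

/-- For `x ≤ 0` one has `x ≤ l x ≤ 0`. This is what makes `l` of a signed variable integrable. -/
theorem abs_le_apply_abs (hl : IsLossFunction l) (x : ℝ) : |l x| ≤ l |x| := by
  rcases le_total 0 x with hx | hx
  · rw [abs_of_nonneg hx, abs_of_nonneg (hx.trans (hl.le_apply x))]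
  · have h := hl.monotone hx
    rw [hl.map_zero] at h
    rw [abs_of_nonpos h, abs_of_nonpos hx]
    linarith [hl.le_apply x, hl.le_apply (-x)]

theorem apply_div_le (hl : IsLossFunction l) (x : ℝ) {a : ℝ} (ha : 1 ≤ a) :
    l (x / a) ≤ l x / a := by
  have ha0 : 0 < a := one_pos.trans_le ha
  have h := hl.convexOn.2 (Set.mem_univ x) (Set.mem_univ 0) (inv_nonneg.2 ha0.le)
    (sub_nonneg.2 (inv_le_one_of_one_le₀ ha)) (by ring)
  simp only [smul_eq_mul, hl.map_zero, mul_zero, add_zero] at h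
  rwa [div_eq_inv_mul, div_eq_inv_mul]

end IsLossFunction

/-! ### Young's inequality and its equality case. -/

section Conjugate

variable {l : ℝ → ℝ}

theorem measurable_convexConjugate (l : ℝ → ℝ) : Measurable (convexConjugate l) := by
  have h : LowerSemicontinuous (fun y => ⨆ x : ℝ, ((x * y - l x : ℝ) : EReal)) :=
    lowerSemicontinuous_iSup fun x => Continuous.lowerSemicontinuous <|
      continuous_coe_real_ereal.comp (by fun_prop)
  exact h.measurable

theorem le_convexConjugate (l : ℝ → ℝ) (x y : ℝ) :
    ((x * y - l x : ℝ) : EReal) ≤ convexConjugate l y :=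
  le_iSup (fun x : ℝ => ((x * y - l x : ℝ) : EReal)) x

/-- The subgradient inequality at `x` says, after rearrangement, that `x` maximizes `y * z - l y`.
-/
theorem convexConjugate_le_iff {x z : ℝ} :
    convexConjugate l z ≤ ((x * z - l x : ℝ) : EReal) ↔ IsSubgradientAt l x z := by
  simp only [convexConjugate, iSup_le_iff, EReal.coe_le_coe_iff, IsSubgradientAt]
  refine forall_congr' fun y => ⟨fun h => ?_, fun h => ?_⟩ <;> nlinarith

theorem IsSubgradientAt.convexConjugate_eq {x z : ℝ} (h : IsSubgradientAt l x z) :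
    convexConjugate l z = ((x * z - l x : ℝ) : EReal) :=
  (convexConjugate_le_iff.2 h).antisymm (le_convexConjugate l x z)

theorem mul_le_add_toReal_convexConjugate {x z : ℝ}
    (hz : convexConjugate l z ≠ ⊤) : x * z ≤ l x + (convexConjugate l z).toReal := by
  have h := le_convexConjugate l x z
  have hbot : convexConjugate l z ≠ ⊥ := ne_of_gt ((EReal.bot_lt_coe _).trans_le h)
  rw [← EReal.coe_toReal hz hbot, EReal.coe_le_coe_iff] at h
  linarith

theorem isSubgradientAt_of_add_toReal_le {x z : ℝ} (hl : IsLossFunction l)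
    (hz : convexConjugate l z ≠ ⊤) (h : l x + (convexConjugate l z).toReal ≤ x * z) :
    IsSubgradientAt l x z := by
  rw [← convexConjugate_le_iff, ← EReal.coe_toReal hz
    (ne_of_gt (EReal.bot_lt_zero.trans_le (convexConjugate_nonneg hl z))), EReal.coe_le_coe_iff]
  linarith

end Conjugate

/-! ### Integrability on the Orlicz heart and the first order condition. -/

section Heart

variable {Ω : Type*} [MeasurableSpace Ω] {P : Measure Ω} [IsProbabilityMeasure P]
  {l : ℝ → ℝ} {hl : IsLossFunction l}

omit [IsProbabilityMeasure P] in
theorem integrable_loss_abs (X : orliczHeart P hl) {c : ℝ} (hc : 0 < c) :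
    Integrable (fun ω => l (c * |X.1 ω|)) P :=
  X.2 c hc

omit [IsProbabilityMeasure P] in
theorem integrable_loss_self (X : orliczHeart P hl) : Integrable (fun ω => l (X.1 ω)) P := by
  refine (integrable_loss_abs X one_pos).mono'
    (hl.monotone.measurable.comp_aemeasurable X.1.aemeasurable).aestronglyMeasurable ?_
  filter_upwards with ω
  rw [one_mul]
  exact hl.abs_le_apply_abs _

omit [IsProbabilityMeasure P] in
theorem integrable_coe (X : orliczHeart P hl) : Integrable (fun ω => X.1 ω) P := by
  refine (integrable_loss_abs X one_pos).mono' X.1.aestronglyMeasurable ?_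
  filter_upwards with ω
  rw [one_mul]
  exact hl.le_apply _

theorem coeFn_affine (X : orliczHeart P hl) (a b : ℝ) :
    ∀ᵐ ω ∂P, (constHeart P hl a + b • X).1 ω = a + b * X.1 ω := by
  filter_upwards [AEEqFun.coeFn_add (constHeart P hl a).1 (b • X).1,
    AEEqFun.coeFn_smul b X.1, AEEqFun.coeFn_const (μ := P) Ω a] with ω h₁ h₂ h₃
  calc (constHeart P hl a + b • X).1 ω = (constHeart P hl a).1 ω + (b • X).1 ω := h₁
    _ = a + b * X.1 ω := by
      rw [show (constHeart P hl a).1 ω = a from h₃]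
      exact congrArg (a + ·) h₂

theorem integrable_loss_affine (X : orliczHeart P hl) (a b : ℝ) :
    Integrable (fun ω => l (a + b * X.1 ω)) P := by
  refine (integrable_loss_self (constHeart P hl a + b • X)).congr ?_
  filter_upwards [coeFn_affine X a b] with ω h
  rw [h]

theorem integrable_loss_sub (X : orliczHeart P hl) (η : ℝ) :
    Integrable (fun ω => l (η - X.1 ω)) P := by
  refine (integrable_loss_affine X η (-1)).congr (.of_forall fun ω => ?_)
  simp only [neg_one_mul, sub_eq_add_neg]

/-- Testing the subgradient one unit to the right gives `0 ≤ Z ≤ l (η + 1 - X) - l (η - X)`. -/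
theorem integrable_of_isSubgradientAt (X : orliczHeart P hl) (η : ℝ) {Z : Ω → ℝ}
    (hZ : AEStronglyMeasurable Z P) (h : ∀ᵐ ω ∂P, IsSubgradientAt l (η - X.1 ω) (Z ω)) :
    Integrable Z P := by
  refine ((integrable_loss_sub X (η + 1)).sub (integrable_loss_sub X η)).mono' hZ ?_
  filter_upwards [h] with ω h
  have h₁ := h (η + 1 - X.1 ω)
  rw [Real.norm_of_nonneg (hl.subgradient_nonneg h)]
  simp only [Pi.sub_apply]
  linarith

theorem integrable_leftDeriv (X : orliczHeart P hl) (η : ℝ) :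
    Integrable (fun ω => leftDeriv l (η - X.1 ω)) P :=
  integrable_of_isSubgradientAt X η
    (hl.measurable_leftDeriv.comp_aemeasurable
      (X.1.aemeasurable.const_sub η)).aestronglyMeasurable
    (.of_forall fun _ => hl.isSubgradientAt_leftDeriv _)

theorem integrable_rightDeriv (X : orliczHeart P hl) (η : ℝ) :
    Integrable (fun ω => rightDeriv l (η - X.1 ω)) P :=
  integrable_of_isSubgradientAt X η
    (hl.measurable_rightDeriv.comp_aemeasurable
      (X.1.aemeasurable.const_sub η)).aestronglyMeasurable
    (.of_forall fun _ => hl.isSubgradientAt_rightDeriv _)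

omit [IsProbabilityMeasure P] in
theorem isOptimalAllocation_iff (X : orliczHeart P hl) (η : ℝ) :
    IsOptimalAllocation P hl X η ↔
      ∀ ξ, allocationCost P hl η X ≤ allocationCost P hl ξ X := by
  constructor
  · intro h ξ
    rw [← EReal.coe_le_coe_iff, ← h]
    exact iInf_le (fun η : ℝ => (allocationCost P hl η X : EReal)) ξ
  · intro h
    exact (iInf_le _ η).antisymm (le_iInf fun ξ => EReal.coe_le_coe_iff.2 (h ξ))

/-- Integrating pointwise subgradients makes `E[Z] - 1` a subgradient of the cost at `η`. -/
theorem allocationCost_add_integral_mul_le (X : orliczHeart P hl) (η ξ : ℝ) {Z : Ω → ℝ}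
    (hZ : Integrable Z P) (h : ∀ᵐ ω ∂P, IsSubgradientAt l (η - X.1 ω) (Z ω)) :
    allocationCost P hl η X + ((∫ ω, Z ω ∂P) - 1) * (ξ - η) ≤ allocationCost P hl ξ X := by
  have key : ∫ ω, (l (η - X.1 ω) + Z ω * (ξ - η)) ∂P ≤ ∫ ω, l (ξ - X.1 ω) ∂P := by
    refine integral_mono_ae ((integrable_loss_sub X η).add (hZ.mul_const _))
      (integrable_loss_sub X ξ) ?_
    filter_upwards [h] with ω h
    have := h (ξ - X.1 ω)
    rwa [sub_sub_sub_cancel_right] at this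
  rw [integral_add (integrable_loss_sub X η) (hZ.mul_const _), integral_mul_const] at key
  unfold allocationCost
  linarith

theorem FirstOrderCondition.isOptimalAllocation {X : orliczHeart P hl} {η : ℝ}
    (h : FirstOrderCondition P hl X η) : IsOptimalAllocation P hl X η := by
  rw [isOptimalAllocation_iff]
  intro ξ
  rcases le_total η ξ with hξ | hξ
  · have := allocationCost_add_integral_mul_le X η ξ (integrable_rightDeriv X η)
      (.of_forall fun _ => hl.isSubgradientAt_rightDeriv _)
    nlinarith [mul_nonneg (sub_nonneg.2 h.2) (sub_nonneg.2 hξ)]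
  · have := allocationCost_add_integral_mul_le X η ξ (integrable_leftDeriv X η)
      (.of_forall fun _ => hl.isSubgradientAt_leftDeriv _)
    nlinarith [mul_nonneg (sub_nonneg.2 h.1) (sub_nonneg.2 hξ)]

/-- Difference quotients of `η ↦ E[l(η - X)]` converge to the expectation of the one-sided
derivative. -/
theorem tendsto_slope_integral_loss (X : orliczHeart P hl) (η : ℝ) {s : ℕ → ℝ} {d : ℝ → ℝ}
    (hs : ∀ n, s n ≠ 0 ∧ |s n| ≤ 1)
    (hd : ∀ x, Filter.Tendsto (fun n => (l (x + s n) - l x) / s n) Filter.atTop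
      (nhds (d x))) :
    Filter.Tendsto (fun n => (allocationCost P hl (η + s n) X - allocationCost P hl η X) / s n)
      Filter.atTop (nhds ((∫ ω, d (η - X.1 ω) ∂P) - 1)) := by
  have key : Filter.Tendsto (fun n => ∫ ω, (l (η - X.1 ω + s n) - l (η - X.1 ω)) / s n ∂P)
      Filter.atTop (nhds (∫ ω, d (η - X.1 ω) ∂P)) := by
    refine tendsto_integral_of_dominated_convergence
      -- Since `|s n| ≤ 1`, every quotient is at most the right derivative at `x + 1`, where `x = η
      -- - X`, and that is at most the increment of `l` from `x + 1` to `x + 2`.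
      (fun ω => l (η + 2 - X.1 ω) - l (η + 1 - X.1 ω)) ?_
      ((integrable_loss_sub X (η + 2)).sub (integrable_loss_sub X (η + 1))) ?_ ?_
    · intro n
      refine AEMeasurable.aestronglyMeasurable (.div_const (.sub ?_ ?_) _)
      · exact hl.monotone.measurable.comp_aemeasurable
          ((X.1.aemeasurable.const_sub η).add_const _)
      · exact hl.monotone.measurable.comp_aemeasurable (X.1.aemeasurable.const_sub η)
    · intro n
      filter_upwards with ω
      set x := η - X.1 ω with hx
      obtain ⟨h0, h1⟩ := hs n
      rw [show η + 2 - X.1 ω = x + 2 by ring, show η + 1 - X.1 ω = x + 1 by ring]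
      set z := rightDeriv l (x + 1)
      have hz := hl.isSubgradientAt_rightDeriv (x + 1) (x + 2)
      have hz0 := hl.subgradient_nonneg (hl.isSubgradientAt_rightDeriv (x + 1))
      have hb : z ≤ l (x + 2) - l (x + 1) := by simp only [z]; linarith
      refine le_trans ?_ hb
      have hmono : ∀ y ≤ x + 1, ∀ w, IsSubgradientAt l y w → w ≤ z := by
        intro y hy w hw
        exact (hl.isSubgradientAt_iff.1 hw).2.trans
          (hl.convexOn.monotoneOn_rightDeriv (by simp) (by simp) hy)
      rw [Real.norm_eq_abs, abs_div, div_le_iff₀ (abs_pos.2 h0)]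
      have ha := abs_le.1 h1
      have hgx := hl.isSubgradientAt_rightDeriv x
      have hgy := hl.isSubgradientAt_rightDeriv (x + s n)
      have e1 := hgx (x + s n)
      have e2 := hgy x
      have m1 := hmono x (by linarith) _ hgx
      have m2 := hmono (x + s n) (by linarith) _ hgy
      have p1 := hl.subgradient_nonneg hgx
      have p2 := hl.subgradient_nonneg hgy
      rcases le_total 0 (s n) with hsn | hsn
      · rw [abs_of_nonneg hsn, abs_of_nonneg (by nlinarith)]
        nlinarith
      · rw [abs_of_nonpos hsn, abs_of_nonpos (by nlinarith)]
        nlinarith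
    · exact .of_forall fun ω => hd _
  refine (key.sub_const 1).congr fun n => ?_
  have hn := (hs n).1
  rw [integral_div, integral_sub ?_ (integrable_loss_sub X η)]
  · unfold allocationCost
    field_simp
    simp only [show ∀ ω, η - X.1 ω + s n = η + s n - X.1 ω from fun ω => by ring]
    ring
  · refine (integrable_loss_sub X (η + s n)).congr (.of_forall fun ω => ?_)
    simp only [show η - X.1 ω + s n = η + s n - X.1 ω by ring]

theorem IsOptimalAllocation.firstOrderCondition {X : orliczHeart P hl} {η : ℝ}
    (h : IsOptimalAllocation P hl X η) : FirstOrderCondition P hl X η := by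
  rw [isOptimalAllocation_iff] at h
  have hu : Filter.Tendsto (fun n : ℕ => 1 / ((n : ℝ) + 1)) Filter.atTop (nhds 0) :=
    tendsto_one_div_add_atTop_nhds_zero_nat
  have hpos : ∀ n : ℕ, 0 < 1 / ((n : ℝ) + 1) := fun n => Nat.one_div_pos_of_nat
  have hle : ∀ n : ℕ, 1 / ((n : ℝ) + 1) ≤ 1 := fun n => by
    rw [div_le_one (by positivity)]
    linarith [n.cast_nonneg (α := ℝ)]
  constructor
  · have := tendsto_slope_integral_loss X η (s := fun n : ℕ => -(1 / ((n : ℝ) + 1)))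
      (d := leftDeriv l) (fun n => ⟨(neg_lt_zero.2 (hpos n)).ne, by
        rw [abs_neg, abs_of_pos (hpos n)]; exact hle n⟩) (fun x => ?_)
    · refine sub_nonpos.1 (le_of_tendsto' this fun n => ?_)
      exact div_nonpos_of_nonneg_of_nonpos (sub_nonneg.2 (h _)) (neg_nonpos.2 (hpos n).le)
    · have hd := (hasDerivWithinAt_iff_tendsto_slope' Set.self_notMem_Iio).mp
        (hl.convexOn.hasDerivWithinAt_leftDeriv_of_mem_interior (x := x) (by simp))
      have ht : Filter.Tendsto (fun n : ℕ => x + -(1 / ((n : ℝ) + 1))) Filter.atTop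
          (nhdsWithin x (Set.Iio x)) := by
        refine tendsto_nhdsWithin_iff.2 ⟨?_, .of_forall fun n => ?_⟩
        · simpa using hu.neg.const_add x
        · exact add_lt_of_neg_right x (neg_lt_zero.2 (hpos n))
      refine (hd.comp ht).congr fun n => ?_
      simp only [Function.comp_apply, slope_def_field, add_sub_cancel_left]
  · have := tendsto_slope_integral_loss X η (s := fun n : ℕ => 1 / ((n : ℝ) + 1))
      (d := rightDeriv l) (fun n => ⟨(hpos n).ne', by
        rw [abs_of_pos (hpos n)]; exact hle n⟩) (fun x => ?_)
    · refine sub_nonneg.1 (ge_of_tendsto' this fun n => ?_)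
      exact div_nonneg (sub_nonneg.2 (h _)) (hpos n).le
    · have hd := (hasDerivWithinAt_iff_tendsto_slope' Set.self_notMem_Ioi).mp
        (hl.convexOn.hasDerivWithinAt_rightDeriv_of_mem_interior (x := x) (by simp))
      have ht : Filter.Tendsto (fun n : ℕ => x + 1 / ((n : ℝ) + 1)) Filter.atTop
          (nhdsWithin x (Set.Ioi x)) := by
        refine tendsto_nhdsWithin_iff.2 ⟨?_, .of_forall fun n => ?_⟩
        · simpa using hu.const_add x
        · exact lt_add_of_pos_right x (hpos n)
      refine (hd.comp ht).congr fun n => ?_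
      simp only [Function.comp_apply, slope_def_field, add_sub_cancel_left]

end Heart

/-! ### Weak duality, the duality gap and dual maximizers. -/

section Duality

variable {Ω : Type*} [MeasurableSpace Ω] {P : Measure Ω} [IsProbabilityMeasure P]
  {l : ℝ → ℝ} {hl : IsLossFunction l} {Q : Measure Ω}

omit [IsProbabilityMeasure P] in
theorem conjugateExpectation_finite (hl : IsLossFunction l) {Y : Ω → ℝ} (hY : AEMeasurable Y P)
    (h : conjugateExpectation P l Y ≠ ⊤) :
    (∀ᵐ ω ∂P, convexConjugate l (Y ω) ≠ ⊤) ∧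
      Integrable (fun ω => (convexConjugate l (Y ω)).toReal) P ∧
      ∫ ω, (convexConjugate l (Y ω)).toReal ∂P = (conjugateExpectation P l Y).toReal := by
  have hm : AEMeasurable (fun ω => (convexConjugate l (Y ω)).toENNReal) P :=
    ((measurable_convexConjugate l).comp_aemeasurable hY).ereal_toENNReal
  have heq : ∀ ω, (convexConjugate l (Y ω)).toENNReal.toReal = (convexConjugate l (Y ω)).toReal :=
    fun ω => EReal.toReal_toENNReal (convexConjugate_nonneg hl _)
  have hfin := ae_lt_top' hm h
  refine ⟨?_, ?_, ?_⟩
  · filter_upwards [hfin] with ω hω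
    exact EReal.toENNReal_ne_top_iff.1 hω.ne
  · simpa only [heq] using integrable_toReal_of_lintegral_ne_top hm h
  · simpa only [heq, conjugateExpectation] using integral_toReal hm hfin

omit [IsProbabilityMeasure P] in
theorem density_nonneg (ω : Ω) : 0 ≤ density P Q ω :=
  ENNReal.toReal_nonneg

omit [IsProbabilityMeasure P] in
theorem measurable_density : Measurable (density P Q) :=
  (Measure.measurable_rnDeriv Q P).ennreal_toReal

theorem integrable_density_mul [IsProbabilityMeasure Q] (hQP : Q ≪ P) {f : Ω → ℝ}
    (hf : Integrable f Q) : Integrable (fun ω => density P Q ω * f ω) P :=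
  (integrable_rnDeriv_smul_iff hQP).2 hf

theorem integral_density_mul [IsProbabilityMeasure Q] (hQP : Q ≪ P) (f : Ω → ℝ) :
    ∫ ω, density P Q ω * f ω ∂P = ∫ ω, f ω ∂Q :=
  integral_rnDeriv_smul hQP

/-- The expectation under a dual measure is bounded by the Luxemburg gauge. -/
theorem exists_integral_abs_le_mul (hQ : Q ∈ dualMeasures P l) :
    ∃ C : ℝ, 0 < C ∧ ∀ (X : orliczHeart P hl), Integrable (fun ω => X.1 ω) Q ∧
      ∀ a : ℝ, 0 < a → ∫ ω, l (|X.1 ω| / a) ∂P ≤ 1 → ∫ ω, |X.1 ω| ∂Q ≤ C * a := by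
  obtain ⟨hprob, hQP, hZ, c, hc, hfin⟩ := hQ
  obtain ⟨hne, hint, -⟩ := conjugateExpectation_finite hl (hZ.abs.const_mul c) hfin.ne
  set g := fun ω => (convexConjugate l (c * |density P Q ω|)).toReal with hg
  have hg0 : 0 ≤ ∫ ω, g ω ∂P :=
    integral_nonneg fun ω => EReal.toReal_nonneg (convexConjugate_nonneg hl _)
  -- Young's inequality for `|X| / a` and `c * density`, multiplied by `a / c`; this scaling makes
  -- the final bound linear in `a`.
  have young : ∀ (X : orliczHeart P hl) (a : ℝ), 0 < a →
      ∀ᵐ ω ∂P, density P Q ω * |X.1 ω| ≤ a / c * (l (|X.1 ω| / a) + g ω) := by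
    intro X a ha
    filter_upwards [hne] with ω hω
    have h := mul_le_add_toReal_convexConjugate (x := |X.1 ω| / a) hω
    rw [abs_of_nonneg (density_nonneg ω)] at h
    calc density P Q ω * |X.1 ω| = a / c * (|X.1 ω| / a * (c * density P Q ω)) := by
          field_simp
      _ ≤ a / c * (l (|X.1 ω| / a) + g ω) := by
          rw [hg]
          simp only [abs_of_nonneg (density_nonneg (P := P) (Q := Q) ω)]
          gcongr
  have hlint : ∀ (X : orliczHeart P hl) (a : ℝ), 0 < a →
      Integrable (fun ω => a / c * (l (|X.1 ω| / a) + g ω)) P := by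
    intro X a ha
    refine (Integrable.add ?_ hint).const_mul _
    refine (X.2 a⁻¹ (inv_pos.2 ha)).congr (.of_forall fun ω => ?_)
    simp only [div_eq_inv_mul]
  have hX : ∀ X : orliczHeart P hl, Integrable (fun ω => X.1 ω) Q := by
    intro X
    refine (integrable_toReal_rnDeriv_mul_iff hQP).1 ((hlint X 1 one_pos).mono' ?_ ?_)
    · exact (measurable_density.aemeasurable.mul X.1.aemeasurable).aestronglyMeasurable
    · filter_upwards [young X 1 one_pos] with ω h
      rwa [Real.norm_eq_abs, abs_mul, abs_of_nonneg ENNReal.toReal_nonneg]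
  refine ⟨(1 + ∫ ω, g ω ∂P) / c, by positivity, fun X => ⟨hX X, fun a ha h => ?_⟩⟩
  rw [← integral_density_mul hQP]
  calc ∫ ω, density P Q ω * |X.1 ω| ∂P ≤ ∫ ω, a / c * (l (|X.1 ω| / a) + g ω) ∂P :=
        integral_mono_ae (integrable_density_mul hQP (hX X).abs) (hlint X a ha) (young X a ha)
    _ = a / c * (∫ ω, l (|X.1 ω| / a) ∂P + ∫ ω, g ω ∂P) := by
        rw [integral_const_mul, integral_add ?_ hint]
        refine (X.2 a⁻¹ (inv_pos.2 ha)).congr (.of_forall fun ω => ?_)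
        simp only [div_eq_inv_mul]
    _ ≤ a / c * (1 + ∫ ω, g ω ∂P) := by gcongr
    _ = (1 + ∫ ω, g ω ∂P) / c * a := by ring

theorem integrable_of_mem_dualMeasures (X : orliczHeart P hl) (hQ : Q ∈ dualMeasures P l) :
    Integrable (fun ω => X.1 ω) Q := by
  obtain ⟨C, -, h⟩ := exists_integral_abs_le_mul (hl := hl) hQ
  exact (h X).1

omit [IsProbabilityMeasure P] in
theorem dualObjective_eq_bot {X : orliczHeart P hl}
    (h : conjugateExpectation P l (density P Q) = ⊤) : dualObjective P hl X Q = ⊥ := by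
  rw [dualObjective, h, EReal.coe_ennreal_top, EReal.sub_top]

omit [IsProbabilityMeasure P] in
theorem dualObjective_eq_coe (X : orliczHeart P hl)
    (h : conjugateExpectation P l (density P Q) ≠ ⊤) :
    dualObjective P hl X Q = ((-∫ ω, X.1 ω ∂Q -
      ∫ ω, (convexConjugate l (density P Q ω)).toReal ∂P : ℝ) : EReal) := by
  rw [dualObjective, (conjugateExpectation_finite hl measurable_density.aemeasurable h).2.2,
    integral_neg, EReal.coe_sub, EReal.coe_ennreal_toReal h]

/-- The duality gap is the integral of the pointwise gap in Young's inequality. -/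
theorem young_gap (X : orliczHeart P hl) (η : ℝ) (hQ : Q ∈ dualMeasures P l)
    (h : conjugateExpectation P l (density P Q) ≠ ⊤) :
    ∃ gap : Ω → ℝ, Integrable gap P ∧ 0 ≤ᵐ[P] gap ∧
      dualObjective P hl X Q = ((allocationCost P hl η X - ∫ ω, gap ω ∂P : ℝ) : EReal) ∧
      ∀ᵐ ω ∂P, gap ω = 0 ↔ IsSubgradientAt l (η - X.1 ω) (density P Q ω) := by
  obtain ⟨hprob, hQP, -⟩ := id hQ
  obtain ⟨hne, hint, -⟩ := conjugateExpectation_finite hl measurable_density.aemeasurable h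
  have hXQ := integrable_of_mem_dualMeasures X hQ
  have hηX : Integrable (fun ω => density P Q ω * (η - X.1 ω)) P :=
    integrable_density_mul hQP ((integrable_const η).sub hXQ)
  refine ⟨fun ω => l (η - X.1 ω) + (convexConjugate l (density P Q ω)).toReal -
    density P Q ω * (η - X.1 ω), ((integrable_loss_sub X η).add hint).sub hηX, ?_, ?_, ?_⟩
  · filter_upwards [hne] with ω hω
    have := mul_le_add_toReal_convexConjugate (x := η - X.1 ω) hω
    simp only [Pi.zero_apply]
    linarith
  · rw [dualObjective_eq_coe X h, integral_sub (f := fun ω => l (η - X.1 ω) +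
      (convexConjugate l (density P Q ω)).toReal) ((integrable_loss_sub X η).add hint) hηX,
      integral_add (integrable_loss_sub X η) hint, integral_density_mul hQP,
      integral_sub (integrable_const η) hXQ, integral_const, probReal_univ, one_smul,
      allocationCost]
    congr 1
    ring
  · filter_upwards [hne] with ω hω
    constructor
    · intro h0
      exact isSubgradientAt_of_add_toReal_le hl hω (by linarith)
    · intro hs
      rw [hs.convexConjugate_eq, EReal.toReal_coe]
      ring

theorem dualObjective_le_allocationCost (X : orliczHeart P hl) (η : ℝ)
    (hQ : Q ∈ dualMeasures P l) :
    dualObjective P hl X Q ≤ (allocationCost P hl η X : EReal) := by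
  by_cases h : conjugateExpectation P l (density P Q) = ⊤
  · rw [dualObjective_eq_bot h]
    exact bot_le
  · obtain ⟨gap, -, h0, heq, -⟩ := young_gap X η hQ h
    rw [heq, EReal.coe_le_coe_iff]
    linarith [integral_nonneg_of_ae h0]

theorem dualObjective_le_oce (X : orliczHeart P hl) (hQ : Q ∈ dualMeasures P l) :
    dualObjective P hl X Q ≤ oce P hl X :=
  le_iInf fun η => dualObjective_le_allocationCost X η hQ

/-- With `x = η - X`, testing the subgradient at `2 * x` gives `l* Z = x * Z - l x ≤ l (2 * x) - 2 *
l x`, which is integrable because the heart is stable under scaling. -/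
theorem conjugateExpectation_lt_top_of_isSubgradientAt (X : orliczHeart P hl) (η : ℝ) {Z : Ω → ℝ}
    (h : ∀ᵐ ω ∂P, IsSubgradientAt l (η - X.1 ω) (Z ω)) :
    conjugateExpectation P l Z < ⊤ := by
  have hint : Integrable (fun ω => l (2 * η + (-2) * X.1 ω) - 2 * l (η - X.1 ω)) P :=
    (integrable_loss_affine X (2 * η) (-2)).sub ((integrable_loss_sub X η).const_mul 2)
  refine lt_of_le_of_lt (lintegral_mono_ae ?_) hint.lintegral_lt_top
  filter_upwards [h] with ω hω
  rw [hω.convexConjugate_eq, EReal.real_coe_toENNReal]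
  refine ENNReal.ofReal_le_ofReal ?_
  have := hω (2 * η + (-2) * X.1 ω)
  linarith

theorem dualObjective_eq_allocationCost_iff (X : orliczHeart P hl) (η : ℝ)
    (hQ : Q ∈ dualMeasures P l) :
    dualObjective P hl X Q = (allocationCost P hl η X : EReal) ↔
      ∀ᵐ ω ∂P, IsSubgradientAt l (η - X.1 ω) (density P Q ω) := by
  constructor
  · intro heq
    have h : conjugateExpectation P l (density P Q) ≠ ⊤ := fun h => by
      rw [dualObjective_eq_bot h] at heq
      exact EReal.bot_ne_coe _ heq
    obtain ⟨gap, hint, h0, heq', hiff⟩ := young_gap X η hQ h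
    rw [heq', EReal.coe_eq_coe_iff] at heq
    have hgap := (integral_eq_zero_iff_of_nonneg_ae h0 hint).1 (by linarith)
    filter_upwards [hgap, hiff] with ω h₁ h₂
    exact h₂.1 h₁
  · intro hs
    obtain ⟨gap, -, -, heq, hiff⟩ := young_gap X η hQ
      (conjugateExpectation_lt_top_of_isSubgradientAt X η hs).ne
    have hgap : gap =ᵐ[P] 0 := by
      filter_upwards [hs, hiff] with ω h₁ h₂
      exact h₂.2 h₁
    rw [heq, integral_congr_ae hgap]
    simp

theorem FirstOrderCondition.exists_dualObjective_eq {X : orliczHeart P hl} {η : ℝ}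
    (h : FirstOrderCondition P hl X η) :
    ∃ Q ∈ dualMeasures P l, dualObjective P hl X Q = oce P hl X := by
  -- The first order condition places 1 between the two expectations, so the intermediate value
  -- theorem yields a weight for which the mixture is a probability density.
  obtain ⟨t, ⟨ht0, ht1⟩, ht⟩ : ∃ t ∈ Set.Icc (0 : ℝ) 1,
      (1 - t) * (∫ ω, leftDeriv l (η - X.1 ω) ∂P) +
        t * (∫ ω, rightDeriv l (η - X.1 ω) ∂P) = 1 := by
    have hc : ContinuousOn (fun t : ℝ => (1 - t) * (∫ ω, leftDeriv l (η - X.1 ω) ∂P) +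
        t * (∫ ω, rightDeriv l (η - X.1 ω) ∂P)) (Set.Icc 0 1) := by fun_prop
    exact intermediate_value_Icc zero_le_one hc ⟨by simpa using h.1, by simpa using h.2⟩
  set Z : Ω → ℝ := fun ω => (1 - t) * leftDeriv l (η - X.1 ω) + t * rightDeriv l (η - X.1 ω)
    with hZdef
  have hZint : Integrable Z P :=
    ((integrable_leftDeriv X η).const_mul _).add ((integrable_rightDeriv X η).const_mul _)
  have hZ1 : ∫ ω, Z ω ∂P = 1 := by
    rw [← ht, hZdef, integral_add ((integrable_leftDeriv X η).const_mul _)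
      ((integrable_rightDeriv X η).const_mul _), integral_const_mul, integral_const_mul]
  have hZs : ∀ ω, IsSubgradientAt l (η - X.1 ω) (Z ω) := by
    intro ω
    have := hl.leftDeriv_le_rightDeriv (η - X.1 ω)
    refine hl.isSubgradientAt_iff.2 ⟨?_, ?_⟩ <;> simp only [hZdef] <;> nlinarith
  have hZ0 : ∀ ω, 0 ≤ Z ω := fun ω => hl.subgradient_nonneg (hZs ω)
  set Q := P.withDensity fun ω => ENNReal.ofReal (Z ω) with hQdef
  have hdens : density P Q =ᵐ[P] Z := by
    filter_upwards [Measure.rnDeriv_withDensity₀ P hZint.aemeasurable.ennreal_ofReal] with ω hω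
    rw [density, hω, ENNReal.toReal_ofReal (hZ0 ω)]
  have hs : ∀ᵐ ω ∂P, IsSubgradientAt l (η - X.1 ω) (density P Q ω) := by
    filter_upwards [hdens] with ω hω
    rw [hω]
    exact hZs ω
  have hQ : Q ∈ dualMeasures P l := by
    refine ⟨⟨?_⟩, withDensity_absolutelyContinuous _ _, measurable_density.aemeasurable,
      1, one_pos, ?_⟩
    · rw [hQdef, withDensity_apply _ MeasurableSet.univ, Measure.restrict_univ,
        ← ofReal_integral_eq_lintegral_ofReal hZint (.of_forall hZ0), hZ1, ENNReal.ofReal_one]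
    · simp only [one_mul, abs_of_nonneg (density_nonneg _)]
      exact conjugateExpectation_lt_top_of_isSubgradientAt X η hs
  refine ⟨Q, hQ, ?_⟩
  rw [h.isOptimalAllocation]
  exact (dualObjective_eq_allocationCost_iff X η hQ).2 hs

end Duality

/-! ### Optimal allocations under strict risk aversion. -/

section Existence

variable {Ω : Type*} [MeasurableSpace Ω] {P : Measure Ω} [IsProbabilityMeasure P]
  {l : ℝ → ℝ} {hl : IsLossFunction l}

theorem neg_integral_le_allocationCost (X : orliczHeart P hl) (η : ℝ) :
    -∫ ω, X.1 ω ∂P ≤ allocationCost P hl η X := by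
  have h : ∫ ω, (η - X.1 ω) ∂P ≤ ∫ ω, l (η - X.1 ω) ∂P :=
    integral_mono ((integrable_const η).sub (integrable_coe X)) (integrable_loss_sub X η)
      fun ω => hl.le_apply _
  rw [integral_sub (integrable_const η) (integrable_coe X), integral_const, probReal_univ,
    one_smul] at h
  unfold allocationCost
  linarith

theorem exists_oce_eq_coe (X : orliczHeart P hl) : ∃ r : ℝ, oce P hl X = (r : EReal) := by
  have hlow : ((-∫ ω, X.1 ω ∂P : ℝ) : EReal) ≤ oce P hl X :=
    le_iInf fun η => EReal.coe_le_coe_iff.2 (neg_integral_le_allocationCost X η)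
  have hup : oce P hl X ≤ (allocationCost P hl 0 X : EReal) := iInf_le _ 0
  refine ⟨(oce P hl X).toReal, (EReal.coe_toReal ?_ ?_).symm⟩
  · exact ne_of_lt (hup.trans_lt (EReal.coe_lt_top _))
  · exact ne_of_gt ((EReal.bot_lt_coe _).trans_le hlow)

theorem convexOn_allocationCost (X : orliczHeart P hl) :
    ConvexOn ℝ Set.univ fun η => allocationCost P hl η X := by
  refine ⟨convex_univ, fun a _ b _ s t hs ht hst => ?_⟩
  have h : ∫ ω, l (s * a + t * b - X.1 ω) ∂P ≤
      ∫ ω, (s * l (a - X.1 ω) + t * l (b - X.1 ω)) ∂P := by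
    refine integral_mono (integrable_loss_sub X _) (((integrable_loss_sub X a).const_mul s).add
      ((integrable_loss_sub X b).const_mul t)) fun ω => ?_
    have hc := hl.convexOn.2 (Set.mem_univ (a - X.1 ω)) (Set.mem_univ (b - X.1 ω)) hs ht hst
    simp only [smul_eq_mul] at hc
    convert hc using 2
    linear_combination X.1 ω * hst
  rw [integral_add ((integrable_loss_sub X a).const_mul s)
      ((integrable_loss_sub X b).const_mul t), integral_const_mul, integral_const_mul] at h
  simp only [allocationCost, smul_eq_mul]
  linarith

theorem affine_le_allocationCost (X : orliczHeart P hl) {k C : ℝ} (h : ∀ x, k * x - C ≤ l x)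
    (η : ℝ) : (k - 1) * η - k * (∫ ω, X.1 ω ∂P) - C ≤ allocationCost P hl η X := by
  have hint : Integrable (fun ω => k * (η - X.1 ω)) P :=
    ((integrable_const η).sub (integrable_coe X)).const_mul k
  have := integral_mono (hint.sub (integrable_const C)) (integrable_loss_sub X η)
    fun ω => h (η - X.1 ω)
  simp only [Pi.sub_apply] at this
  rw [integral_sub hint (integrable_const C), integral_const_mul,
    integral_sub (integrable_const η) (integrable_coe X), integral_const, integral_const,
    probReal_univ, one_smul, one_smul] at this
  unfold allocationCost
  linarith

/-- Tangents at `N` and `-N` for large `N`: as the tangent lies below `l 0 = 0` at the origin, `l N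
> N` forces slope above 1, and `l (-N) > -N` forces slope below 1. Integrated, these two minorants
make the cost coercive at both ends. -/
theorem StrictlyAboveAtInfinity.exists_affine_le (hl : IsLossFunction l)
    (hA : StrictlyAboveAtInfinity l) :
    ∃ a b C : ℝ, 1 < a ∧ b < 1 ∧ (∀ x, a * x - C ≤ l x) ∧ ∀ x, b * x - C ≤ l x := by
  obtain ⟨M, hM⟩ := hA
  have hN : 0 < |M| + 1 := by positivity
  set N := |M| + 1 with hNdef
  have h₁ : N < l N := hM N (by rw [abs_of_pos hN, hNdef]; linarith [le_abs_self M])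
  have h₂ : -N < l (-N) := hM (-N) (by rw [abs_neg, abs_of_pos hN, hNdef]; linarith [le_abs_self M])
  set a := rightDeriv l N
  set b := rightDeriv l (-N)
  have ha := hl.isSubgradientAt_rightDeriv N
  have hb := hl.isSubgradientAt_rightDeriv (-N)
  have ha0 := ha 0
  have hb0 := hb 0
  rw [hl.map_zero] at ha0 hb0
  refine ⟨a, b, max (a * N - l N) (b * (-N) - l (-N)), ?_, ?_, fun x => ?_, fun x => ?_⟩
  · by_contra! hcon
    simp only [a] at hcon
    nlinarith
  · by_contra! hcon
    simp only [b] at hcon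
    nlinarith
  · have := ha x
    have := le_max_left (a * N - l N) (b * (-N) - l (-N))
    simp only [a] at *
    linarith
  · have := hb x
    have := le_max_right (a * N - l N) (b * (-N) - l (-N))
    simp only [b] at *
    linarith

theorem StrictlyAboveAtInfinity.exists_isOptimalAllocation (hA : StrictlyAboveAtInfinity l)
    (X : orliczHeart P hl) : ∃ η, IsOptimalAllocation P hl X η := by
  obtain ⟨a, b, C, ha, hb, hla, hlb⟩ := hA.exists_affine_le hl
  have hcont : Continuous fun η => allocationCost P hl η X := by
    rw [← continuousOn_univ]
    exact (convexOn_allocationCost X).continuousOn isOpen_univ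
  have htop : Filter.Tendsto (fun η => allocationCost P hl η X) Filter.atTop Filter.atTop := by
    refine Filter.tendsto_atTop_mono (affine_le_allocationCost X hla) ?_
    simp only [sub_sub]
    exact Filter.tendsto_atTop_add_const_right _ _
      (Filter.tendsto_id.const_mul_atTop (sub_pos.2 ha))
  have hbot : Filter.Tendsto (fun η => allocationCost P hl η X) Filter.atBot Filter.atTop := by
    refine Filter.tendsto_atTop_mono (affine_le_allocationCost X hlb) ?_
    simp only [sub_sub]
    exact Filter.tendsto_atTop_add_const_right _ _
      (Filter.tendsto_id.const_mul_atBot_of_neg (sub_neg.2 hb))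
  obtain ⟨η, hη⟩ := hcont.exists_forall_le (by
    rw [cocompact_eq_atBot_atTop]
    exact hbot.sup htop)
  exact ⟨η, (isOptimalAllocation_iff X η).2 hη⟩

/-- The convex function `l x - x` has its minimum at 0, so it is nondecreasing on the right
half-line; the next lemma is the mirror image. -/
theorem IsLossFunction.sub_le_sub_of_nonneg (hl : IsLossFunction l) {x y : ℝ} (hx : 0 ≤ x)
    (hxy : x ≤ y) : y - x ≤ l y - l x := by
  have h := hl.isSubgradientAt_rightDeriv x
  have h0 := h 0
  rw [hl.map_zero] at h0
  rcases hx.eq_or_lt with rfl | hx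
  · rw [hl.map_zero]
    linarith [hl.le_apply y]
  · have h1 : 1 ≤ rightDeriv l x := by
      have := hl.le_apply x
      by_contra! hc
      nlinarith
    nlinarith [h y]

theorem IsLossFunction.sub_le_sub_of_nonpos (hl : IsLossFunction l) {x y : ℝ} (hx : x ≤ 0)
    (hyx : y ≤ x) : y - x ≤ l y - l x := by
  have h := hl.isSubgradientAt_leftDeriv x
  have h0 := h 0
  rw [hl.map_zero] at h0
  rcases hx.eq_or_lt with rfl | hx
  · rw [hl.map_zero]
    linarith [hl.le_apply y]
  · have h1 : leftDeriv l x ≤ 1 := by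
      have := hl.le_apply x
      by_contra! hc
      nlinarith
    nlinarith [h y]

theorem allocationCost_le_of_ae_sub_le (X : orliczHeart P hl) {η ξ : ℝ}
    (h : ∀ᵐ ω ∂P, (ξ - X.1 ω) - (η - X.1 ω) ≤ l (ξ - X.1 ω) - l (η - X.1 ω)) :
    allocationCost P hl η X ≤ allocationCost P hl ξ X := by
  have : ∫ _, (ξ - η) ∂P ≤ ∫ ω, (l (ξ - X.1 ω) - l (η - X.1 ω)) ∂P := by
    refine integral_mono_ae (integrable_const _)
      ((integrable_loss_sub X ξ).sub (integrable_loss_sub X η)) ?_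
    filter_upwards [h] with ω h
    linarith
  rw [integral_sub (integrable_loss_sub X ξ) (integrable_loss_sub X η), integral_const,
    probReal_univ, one_smul] at this
  unfold allocationCost
  linarith

/-- Clamp `η` to the essential range. If `η` exceeds the essential supremum `r`, then `r - X ≥ 0`
a.s., and monotonicity of `l x - x` on the right half-line shows that lowering `η` to `r` does not
raise the cost; the other end is symmetric. -/
theorem exists_isOptimalAllocation_between (X : orliczHeart P hl) {η : ℝ}
    (hη : IsOptimalAllocation P hl X η) :
    ∃ ξ, IsOptimalAllocation P hl X ξ ∧ essInf (fun ω => (X.1 ω : EReal)) P ≤ (ξ : EReal) ∧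
      (ξ : EReal) ≤ essSup (fun ω => (X.1 ω : EReal)) P := by
  set i := essInf (fun ω => (X.1 ω : EReal)) P
  set s := essSup (fun ω => (X.1 ω : EReal)) P
  have hi : ∀ᵐ ω ∂P, i ≤ X.1 ω := ae_essInf_le
  have hs : ∀ᵐ ω ∂P, (X.1 ω : EReal) ≤ s := ae_le_essSup
  obtain ⟨ω₀, hi₀, hs₀⟩ := (hi.and hs).exists
  have his : i ≤ s := hi₀.trans hs₀
  rw [isOptimalAllocation_iff] at hη
  by_cases h₁ : s < η
  -- The essential supremum is finite: it is below `η` and above the real value of `X` at `ω₀`.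
  · obtain ⟨r, hr⟩ : ∃ r : ℝ, s = r := ⟨s.toReal, (EReal.coe_toReal
      (ne_of_lt (h₁.trans (EReal.coe_lt_top _)))
      (ne_of_gt ((EReal.bot_lt_coe _).trans_le hs₀))).symm⟩
    refine ⟨r, (isOptimalAllocation_iff X r).2 fun ξ => le_trans ?_ (hη ξ), hr ▸ his, hr.ge⟩
    refine allocationCost_le_of_ae_sub_le X ?_
    filter_upwards [hs] with ω hω
    rw [hr, EReal.coe_le_coe_iff] at hω
    rw [hr, EReal.coe_lt_coe_iff] at h₁
    exact hl.sub_le_sub_of_nonneg (by linarith) (by linarith)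
  by_cases h₂ : (η : EReal) < i
  · obtain ⟨r, hr⟩ : ∃ r : ℝ, i = r := ⟨i.toReal, (EReal.coe_toReal
      (ne_of_lt (hi₀.trans_lt (EReal.coe_lt_top _)))
      (ne_of_gt ((EReal.bot_lt_coe _).trans h₂))).symm⟩
    refine ⟨r, (isOptimalAllocation_iff X r).2 fun ξ => le_trans ?_ (hη ξ), hr.le, hr ▸ his⟩
    refine allocationCost_le_of_ae_sub_le X ?_
    filter_upwards [hi] with ω hω
    rw [hr, EReal.coe_le_coe_iff] at hω
    rw [hr, EReal.coe_lt_coe_iff] at h₂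
    exact hl.sub_le_sub_of_nonpos (by linarith) (by linarith)
  exact ⟨η, (isOptimalAllocation_iff X η).2 hη, not_lt.1 h₂, not_lt.1 h₁⟩

end Existence

/-! ### The case where `l` is the identity on a half-line. -/

section RiskNeutral

variable {Ω : Type*} [MeasurableSpace Ω] {P : Measure Ω} [IsProbabilityMeasure P]
  {l : ℝ → ℝ} {hl : IsLossFunction l}

/-- A strict inequality `l x > x` at one point of each half-line propagates outwards by monotonicity
of `l x - x`, which would give strictness at infinity. -/
theorem IsLossFunction.eq_self_of_not_strictlyAboveAtInfinity (hl : IsLossFunction l)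
    (hA : ¬ StrictlyAboveAtInfinity l) : (∀ x, 0 ≤ x → l x = x) ∨ ∀ x, x ≤ 0 → l x = x := by
  by_contra! hcon
  obtain ⟨⟨a, ha, hla⟩, b, hb, hlb⟩ := hcon
  have hla : a < l a := lt_of_le_of_ne (hl.le_apply a) hla.symm
  have hlb : b < l b := lt_of_le_of_ne (hl.le_apply b) hlb.symm
  refine hA ⟨max a (-b), fun x hx => ?_⟩
  rcases le_total 0 x with h0 | h0
  · rw [abs_of_nonneg h0] at hx
    linarith [hl.sub_le_sub_of_nonneg ha ((le_max_left _ _).trans hx)]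
  · rw [abs_of_nonpos h0] at hx
    linarith [hl.sub_le_sub_of_nonpos hb (y := x) (by linarith [(le_max_right a (-b)).trans hx])]

/-- The cost at `s n` is `-E[X]` plus the mean of `l u - u` at `u = s n - X`. This excess vanishes
eventually at each point and is dominated by its value at allocation 0. -/
theorem oce_le_neg_integral_of_eventually_eq (X : orliczHeart P hl) {s : ℕ → ℝ}
    (hle : ∀ n x, l (s n - x) - (s n - x) ≤ l (-x) + x)
    (hev : ∀ x, ∀ᶠ n in Filter.atTop, l (s n - x) = s n - x) :
    oce P hl X ≤ ((-∫ ω, X.1 ω ∂P : ℝ) : EReal) := by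
  have hint : ∀ n, Integrable (fun ω => s n - X.1 ω) P :=
    fun n => (integrable_const _).sub (integrable_coe X)
  have hlim : Filter.Tendsto (fun n => ∫ ω, (l (s n - X.1 ω) - (s n - X.1 ω)) ∂P) Filter.atTop
      (nhds (∫ _, (0 : ℝ) ∂P)) := by
    refine tendsto_integral_of_dominated_convergence (fun ω => l (0 - X.1 ω) + X.1 ω)
      (fun n => ((integrable_loss_sub X (s n)).sub (hint n)).aestronglyMeasurable)
      ((integrable_loss_sub X 0).add (integrable_coe X)) (fun n => .of_forall fun ω => ?_)
      (.of_forall fun ω => ?_)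
    · rw [Real.norm_of_nonneg (sub_nonneg.2 (hl.le_apply _)), zero_sub]
      exact hle n _
    · refine tendsto_const_nhds.congr' ?_
      filter_upwards [hev (X.1 ω)] with n hn
      rw [hn, sub_self]
  have hcost : Filter.Tendsto (fun n => allocationCost P hl (s n) X) Filter.atTop
      (nhds (-∫ ω, X.1 ω ∂P)) := by
    have := hlim.sub_const (∫ ω, X.1 ω ∂P)
    rw [integral_zero, zero_sub] at this
    refine this.congr fun n => ?_
    rw [integral_sub (integrable_loss_sub X (s n)) (hint n),
      integral_sub (integrable_const _) (integrable_coe X), integral_const, probReal_univ,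
      one_smul, allocationCost]
    ring
  exact ge_of_tendsto' (continuous_coe_real_ereal.continuousAt.tendsto.comp hcost)
    fun n => iInf_le _ (s n)

theorem oce_le_neg_integral (hA : ¬ StrictlyAboveAtInfinity l) (X : orliczHeart P hl) :
    oce P hl X ≤ ((-∫ ω, X.1 ω ∂P : ℝ) : EReal) := by
  rcases hl.eq_self_of_not_strictlyAboveAtInfinity hA with h | h
  -- Pushing the allocation to `+∞` moves `s n - x` into the half-line where `l` is the identity;
  -- the second case uses `-∞`.
  · refine oce_le_neg_integral_of_eventually_eq X (s := fun n => n) (fun n x => ?_) fun x => ?_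
    · rcases le_total 0 ((n : ℝ) - x) with h0 | h0
      · rw [h _ h0]
        linarith [hl.le_apply (-x)]
      · linarith [hl.sub_le_sub_of_nonpos h0 (y := -x) (by linarith [n.cast_nonneg (α := ℝ)])]
    · filter_upwards [tendsto_natCast_atTop_atTop.eventually_ge_atTop x] with n hn
      exact h _ (sub_nonneg.2 hn)
  · refine oce_le_neg_integral_of_eventually_eq X (s := fun n => -n) (fun n x => ?_) fun x => ?_
    · rcases le_total (-(n : ℝ) - x) 0 with h0 | h0
      · rw [h _ h0]
        linarith [hl.le_apply (-x)]
      · linarith [hl.sub_le_sub_of_nonneg h0 (y := -x) (by linarith [n.cast_nonneg (α := ℝ)])]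
    · filter_upwards [tendsto_natCast_atTop_atTop.eventually_ge_atTop (-x)] with n hn
      exact h _ (by linarith)

theorem convexConjugate_one (hl : IsLossFunction l) : convexConjugate l 1 = 0 := by
  have h : IsSubgradientAt l 0 1 := fun y => by
    rw [hl.map_zero]
    linarith [hl.le_apply y]
  rw [h.convexConjugate_eq, hl.map_zero]
  simp

theorem conjugateExpectation_density_self (hl : IsLossFunction l) :
    conjugateExpectation P l (density P P) = 0 := by
  have : (fun ω => (convexConjugate l (density P P ω)).toENNReal) =ᵐ[P] 0 := by
    filter_upwards [Measure.rnDeriv_self P] with ω hω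
    rw [density, hω, ENNReal.toReal_one, convexConjugate_one hl, EReal.toENNReal_zero]
    rfl
  rw [conjugateExpectation, lintegral_congr_ae this]
  exact lintegral_zero

theorem self_mem_dualMeasures (hl : IsLossFunction l) : P ∈ dualMeasures P l := by
  refine ⟨inferInstance, Measure.AbsolutelyContinuous.rfl, measurable_density.aemeasurable,
    1, one_pos, ?_⟩
  simp only [one_mul, abs_of_nonneg (density_nonneg _)]
  rw [conjugateExpectation_density_self hl]
  exact ENNReal.zero_lt_top

theorem exists_dualObjective_eq_oce (X : orliczHeart P hl) :
    ∃ Q ∈ dualMeasures P l, dualObjective P hl X Q = oce P hl X := by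
  by_cases hA : StrictlyAboveAtInfinity l
  · obtain ⟨η, hη⟩ := hA.exists_isOptimalAllocation X
    exact hη.firstOrderCondition.exists_dualObjective_eq
  · refine ⟨P, self_mem_dualMeasures hl,
      (dualObjective_le_oce X (self_mem_dualMeasures hl)).antisymm ?_⟩
    rw [dualObjective, conjugateExpectation_density_self hl, EReal.coe_ennreal_zero, sub_zero,
      integral_neg]
    exact oce_le_neg_integral hA X

end RiskNeutral

/-! ### Risk measure properties and lower semicontinuity. -/

section RiskMeasure

variable {Ω : Type*} [MeasurableSpace Ω] {P : Measure Ω} [IsProbabilityMeasure P]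
  {l : ℝ → ℝ} {hl : IsLossFunction l}

/-- The OCE has an affine minorant of dual form that is exact at a given position. -/
theorem exists_exact_minorant (X : orliczHeart P hl) :
    ∃ Q ∈ dualMeasures P l, ∃ c : ℝ, oce P hl X = ((-(∫ ω, X.1 ω ∂Q) - c : ℝ) : EReal) ∧
      ∀ Y : orliczHeart P hl, ((-(∫ ω, Y.1 ω ∂Q) - c : ℝ) : EReal) ≤ oce P hl Y := by
  obtain ⟨Q, hQ, hX⟩ := exists_dualObjective_eq_oce X
  obtain ⟨r, hr⟩ := exists_oce_eq_coe X
  have h : conjugateExpectation P l (density P Q) ≠ ⊤ := fun h => by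
    rw [dualObjective_eq_bot h, hr] at hX
    exact EReal.bot_ne_coe _ hX
  refine ⟨Q, hQ, ∫ ω, (convexConjugate l (density P Q ω)).toReal ∂P, ?_, fun Y => ?_⟩
  · rw [← hX, dualObjective_eq_coe X h]
  · rw [← dualObjective_eq_coe Y h]
    exact dualObjective_le_oce Y hQ

theorem integral_affineCombination (X Y : orliczHeart P hl) (s t : ℝ) {Q : Measure Ω}
    (hQ : Q ∈ dualMeasures P l) :
    ∫ ω, (s • X + t • Y).1 ω ∂Q = s * (∫ ω, X.1 ω ∂Q) + t * ∫ ω, Y.1 ω ∂Q := by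
  have h : (fun ω => (s • X + t • Y).1 ω) =ᵐ[Q] fun ω => s * X.1 ω + t * Y.1 ω := by
    refine hQ.2.1.ae_eq ?_
    filter_upwards [AEEqFun.coeFn_add (s • X).1 (t • Y).1, AEEqFun.coeFn_smul s X.1,
      AEEqFun.coeFn_smul t Y.1] with ω h₁ h₂ h₃
    calc (s • X + t • Y).1 ω = (s • X).1 ω + (t • Y).1 ω := h₁
      _ = s * X.1 ω + t * Y.1 ω := congrArg₂ (· + ·) h₂ h₃
  rw [integral_congr_ae h, integral_add ((integrable_of_mem_dualMeasures X hQ).const_mul s)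
    ((integrable_of_mem_dualMeasures Y hQ).const_mul t), integral_const_mul, integral_const_mul]

theorem isRiskMeasure_oce : IsRiskMeasure P hl (oce P hl) := by
  refine ⟨fun X Y t ht0 ht1 => ?_, fun X Y h => ?_⟩
  -- The minorant exact at the mixture is affine, so its value there is at most the larger of its
  -- values at `X` and `Y`.
  · obtain ⟨Q, hQ, c, heq, hle⟩ := exists_exact_minorant (t • X + (1 - t) • Y)
    have hX := hle X
    have hY := hle Y
    rw [heq, integral_affineCombination X Y _ _ hQ]
    rcases le_total (∫ ω, X.1 ω ∂Q) (∫ ω, Y.1 ω ∂Q) with h | h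
    · refine le_max_of_le_left (le_trans (EReal.coe_le_coe_iff.2 ?_) hX)
      nlinarith
    · refine le_max_of_le_right (le_trans (EReal.coe_le_coe_iff.2 ?_) hY)
      nlinarith
  · refine iInf_mono fun η => EReal.coe_le_coe_iff.2 (sub_le_sub_right ?_ η)
    refine integral_mono_ae (integrable_loss_sub Y η) (integrable_loss_sub X η) ?_
    filter_upwards [AEEqFun.coeFn_le.2 h] with ω hω
    exact hl.monotone (by linarith)

theorem allocationCost_add_const (X : orliczHeart P hl) (m η : ℝ) :
    allocationCost P hl η (X + constHeart P hl m) = allocationCost P hl (η - m) X - m := by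
  have h : ∫ ω, l (η - (X + constHeart P hl m).1 ω) ∂P = ∫ ω, l (η - m - X.1 ω) ∂P := by
    refine integral_congr_ae ?_
    filter_upwards [coeFn_affine X m 1] with ω hω
    rw [one_smul, one_mul, add_comm] at hω
    rw [hω, sub_sub]
  unfold allocationCost
  rw [h]
  ring

theorem oce_add_const_le (X : orliczHeart P hl) (m : ℝ) :
    oce P hl (X + constHeart P hl m) ≤ oce P hl X - (m : EReal) := by
  rw [EReal.le_sub_iff_add_le (.inl (EReal.coe_ne_bot m)) (.inl (EReal.coe_ne_top m))]
  refine le_iInf fun η => ?_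
  rw [← EReal.le_sub_iff_add_le (.inl (EReal.coe_ne_bot m)) (.inl (EReal.coe_ne_top m)),
    ← EReal.coe_sub]
  have h := allocationCost_add_const X m (η + m)
  rw [add_sub_cancel_right] at h
  rw [← h]
  exact iInf_le _ (η + m)

theorem isCashAdditive_oce : IsCashAdditive P hl (oce P hl) := by
  refine fun X m => (oce_add_const_le X m).antisymm (le_iInf fun η => ?_)
  rw [allocationCost_add_const, EReal.coe_sub]
  exact EReal.sub_le_sub (iInf_le _ (η - m)) le_rfl

omit [IsProbabilityMeasure P] in
theorem exists_gauge_lt_of_luxemburgNorm_lt (X : orliczHeart P hl) {ε : ℝ}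
    (h : luxemburgNorm P hl X < ε) : ∃ a, 0 < a ∧ a < ε ∧ ∫ ω, l (|X.1 ω| / a) ∂P ≤ 1 := by
  -- Nonemptiness is needed, since the infimum of an empty set of reals is 0 by convention.
  -- Convexity gives `l (x / a) ≤ l x / a` for `a ≥ 1`, so `a = max 1 E[l |X|]` is admissible.
  have hne : {a : ℝ | 0 < a ∧ ∫ ω, l (|X.1 ω| / a) ∂P ≤ 1}.Nonempty := by
    have hint : Integrable (fun ω => l |X.1 ω|) P := by simpa using X.2 1 one_pos
    set a := max 1 (∫ ω, l |X.1 ω| ∂P)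
    have ha : 1 ≤ a := le_max_left _ _
    have ha0 : 0 < a := one_pos.trans_le ha
    refine ⟨a, ha0, ?_⟩
    calc ∫ ω, l (|X.1 ω| / a) ∂P ≤ ∫ ω, l |X.1 ω| / a ∂P := by
          refine integral_mono ?_ (hint.div_const a) fun ω => hl.apply_div_le _ ha
          refine (X.2 a⁻¹ (inv_pos.2 ha0)).congr (.of_forall fun ω => ?_)
          simp only [div_eq_inv_mul]
      _ ≤ 1 := by
          rw [integral_div, div_le_one ha0]
          exact le_max_right _ _
  obtain ⟨a, ⟨ha0, ha⟩, hlt⟩ := exists_lt_of_csInf_lt hne h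
  exact ⟨a, ha0, hlt, ha⟩

theorem lowerSemicontinuous_oce :
    @LowerSemicontinuous _ _ (luxemburgTopology P hl) _ (oce P hl) := by
  let _ := luxemburgTopology P hl
  rw [lowerSemicontinuous_iff_isOpen_preimage]
  intro y X (hX : y < oce P hl X)
  obtain ⟨Q, hQ, c, heq, hle⟩ := exists_exact_minorant X
  obtain ⟨hprob, hQP, -⟩ := id hQ
  obtain ⟨C, hC, hbound⟩ := exists_integral_abs_le_mul (hl := hl) hQ
  rw [heq] at hX
  obtain ⟨r, hyr, hr⟩ := EReal.lt_iff_exists_real_btwn.1 hX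
  rw [EReal.coe_lt_coe_iff] at hr
  -- The exact minorant is Lipschitz with constant `C` for the Luxemburg gauge, so the slack above
  -- `r` divided by `C` is a suitable radius.
  refine ⟨(-(∫ ω, X.1 ω ∂Q) - c - r) / C, div_pos (sub_pos.2 hr) hC, fun Y hY => ?_⟩
  obtain ⟨a, ha0, haε, ha⟩ := exists_gauge_lt_of_luxemburgNorm_lt _ hY
  have h := (hbound (Y - X)).2 a ha0 ha
  have hYX : ∫ ω, (Y - X).1 ω ∂Q = ∫ ω, Y.1 ω ∂Q - ∫ ω, X.1 ω ∂Q := by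
    rw [← integral_sub (integrable_of_mem_dualMeasures Y hQ)
      (integrable_of_mem_dualMeasures X hQ)]
    exact integral_congr_ae (hQP.ae_eq (AEEqFun.coeFn_sub Y.1 X.1))
  have habs := (le_abs_self _).trans (abs_integral_le_integral_abs (f := (Y - X).1) (μ := Q))
  rw [lt_div_iff₀ hC] at haε
  refine (hyr.trans (EReal.coe_lt_coe_iff.2 ?_)).trans_le (hle Y)
  linarith

end RiskMeasure

/-! ### Assembly of the five statements. -/

theorem mainTheorem6 {Ω : Type*} [MeasurableSpace Ω] (P : Measure Ω) [IsProbabilityMeasure P]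
    {l : ℝ → ℝ} (hl : IsLossFunction l) :
    -- the OCE is a real-valued, lower semicontinuous, cash additive risk measure
    ((∀ (X : orliczHeart P hl) (η : ℝ), Integrable (fun ω => l (η - X.1 ω)) P) ∧
      (∀ X : orliczHeart P hl, ∃ r : ℝ, oce P hl X = (r : EReal)) ∧
      IsRiskMeasure P hl (oce P hl) ∧
      IsCashAdditive P hl (oce P hl) ∧
      @LowerSemicontinuous _ _ (luxemburgTopology P hl) _ (oce P hl)) ∧
    -- existence of an optimal allocation between the essential bounds of `X`
    (StrictlyAboveAtInfinity l → ∀ X : orliczHeart P hl, ∃ η : ℝ,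
      IsOptimalAllocation P hl X η ∧
      essInf (fun ω => (X.1 ω : EReal)) P ≤ (η : EReal) ∧
      (η : EReal) ≤ essSup (fun ω => (X.1 ω : EReal)) P ∧
      FirstOrderCondition P hl X η) ∧
    -- characterization of the optimal allocations
    (∀ (X : orliczHeart P hl) (η : ℝ),
      Integrable (fun ω => leftDeriv l (η - X.1 ω)) P ∧
      Integrable (fun ω => rightDeriv l (η - X.1 ω)) P ∧
      (IsOptimalAllocation P hl X η ↔ FirstOrderCondition P hl X η)) ∧
    -- dual representation, with a maximum
    (∀ X : orliczHeart P hl,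
      (∀ Q ∈ dualMeasures P l, Integrable (fun ω => X.1 ω) Q) ∧
      IsGreatest (dualObjective P hl X '' dualMeasures P l) (oce P hl X)) ∧
    -- the measures at which the maximum is attained
    (∀ (X : orliczHeart P hl) (η : ℝ), FirstOrderCondition P hl X η →
      ∀ Q ∈ dualMeasures P l,
        (dualObjective P hl X Q = oce P hl X ↔
          ∀ᵐ ω ∂P, leftDeriv l (η - X.1 ω) ≤ density P Q ω ∧
            density P Q ω ≤ rightDeriv l (η - X.1 ω))) := by
  refine ⟨⟨integrable_loss_sub, exists_oce_eq_coe, isRiskMeasure_oce, isCashAdditive_oce,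
    lowerSemicontinuous_oce⟩, fun hA X => ?_, fun X η => ⟨integrable_leftDeriv X η,
    integrable_rightDeriv X η, fun h => h.firstOrderCondition, fun h => h.isOptimalAllocation⟩,
    fun X => ⟨fun Q hQ => integrable_of_mem_dualMeasures X hQ,
      exists_dualObjective_eq_oce X, ?_⟩, fun X η hη Q hQ => ?_⟩
  · obtain ⟨η, hη⟩ := hA.exists_isOptimalAllocation X
    obtain ⟨ξ, hξ, h₁, h₂⟩ := exists_isOptimalAllocation_between X hη
    exact ⟨ξ, hξ, h₁, h₂, hξ.firstOrderCondition⟩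
  · rintro _ ⟨Q, hQ, rfl⟩
    exact dualObjective_le_oce X hQ
  · rw [hη.isOptimalAllocation, dualObjective_eq_allocationCost_iff X η hQ]
    simp only [hl.isSubgradientAt_iff]
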